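/- There is exactly one real sequence $(a_k)_{k\ge 0}$ (the Stirling coefficients) such that $$n!\sim n^n e^{-n}\sqrt{2\pi n}\,\sum_{k\ge 0}\frac{a_k}{n^k}\qquad(n\to\infty)$$ in the sense of Poincaré, i.e. such that for every integer $N\ge 0$, $$\frac{n!}{n^n e^{-n}\sqrt{2\pi n}}-\sum_{k=0}^{N}\frac{a_k}{n^k}=o\!\left(n^{-N}\right)\qquad(n\to\infty),$$ and it is given, for every integer $k\ge 0$, by $$a_k=\frac{(2k)!}{2^k\,k!}\sum_{i=0}^{2k}\binom{k+i-1/2}{i}\binom{3k+1/2}{2k-i}2^i\sum_{j=0}^{i}\binom{i}{j}(-1)^j\,j!\,\frac{S(2k+i+j,\,j)}{(2k+i+j)!}.$$ Here $S(p,q)$ denotes the Stirling number of the second kind, i.e. the number of partitions of a $p$-element set into $q$ non-empty blocks (with $S(0,0)=1$), and $\binom{x}{m}=\frac{x(x-1)\cdots(x-m+1)}{m!}$ for real $x$ and integer $m\ge 0$. -/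

import Mathlib

open Filter Asymptotics

/-- The function `f` has the (Poincaré) asymptotic expansion
`f n ~ ∑_{k ≥ 0} a k / n ^ k` as `n → ∞`: for every `N`, the partial sum up to and including
`k = N` approximates `f n` with an error `o(1 / n ^ N)`. The series need not converge. -/
def HasAsymptoticExpansion (f : ℕ → ℝ) (a : ℕ → ℝ) : Prop :=
  ∀ N : ℕ, (fun n : ℕ => f n - ∑ k ∈ Finset.range (N + 1), a k / (n : ℝ) ^ k)
    =o[atTop] (fun n : ℕ => 1 / (n : ℝ) ^ N)

/-- `a` is the sequence of Stirling coefficients: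
`n! ~ n ^ n * e ^ (-n) * √(2 π n) * ∑_{k ≥ 0} a k / n ^ k` as `n → ∞`. -/
def IsStirlingCoefficients (a : ℕ → ℝ) : Prop :=
  HasAsymptoticExpansion
    (fun n : ℕ => (n.factorial : ℝ) /
      ((n : ℝ) ^ n * Real.exp (-(n : ℝ)) * Real.sqrt (2 * Real.pi * (n : ℝ)))) a

open Topology PowerSeries MeasureTheory

/-! The proof is Laplace's method followed by coefficient extraction. Substituting y = n e^{x/√n} in
Euler's integral for Γ(n) gives n! = n^n e^{-n} √n ∫ exp(-(x²/2) R(x/√n)) dx, where R(t) = 2(e^t - 1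
- t)/t² (`factorial_eq_integral_gammaPhase`, `gammaPhase_eq`). Factor out e^{-x²/2} and expand
exp(-(x²/2)(R(t) - 1)) to order M in t = x/√n. The error is at most a constant times n^{-M/2}/(1 +
x²) for all x (`exists_abs_exp_neg_gammaPhase_sub_le`), so it may be integrated. Odd Gaussian
moments vanish, only integer powers of 1/n survive, and their coefficients are `laplaceCoeff`.

The moments turn the sum over j into a binomial series: `laplaceCoeff k` is (2k)!/(2^k k!) times the
coefficient of t^{2k} in R^{-(k+1/2)}. Rewriting this power through the natural powers R^i, whose
coefficients involve Stirling numbers, gives the closed form (`sum_gaussianMoment_mul_coeff`).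
Uniqueness holds for every Poincaré expansion. -/

/-! ### Formal power series and the closed form -/

theorem coeff_exp_sub_one_pow (j n : ℕ) :
    coeff n ((exp ℝ - 1) ^ j) =
      (j.factorial : ℝ) * ((Nat.stirlingSecond n j : ℝ) / (n.factorial : ℝ)) := by
  induction n generalizing j with
  | zero =>
    rcases j with _ | j
    · simp
    · simp
  | succ n ih =>
    rcases j with _ | j
    · simp [coeff_one]
    -- On coefficients, this differential equation is the recurrence of the Stirling numbers.
    · have hd : derivative ℝ ((exp ℝ - 1) ^ (j + 1)) =
          ((j + 1 : ℕ) : ℝ⟦X⟧) * ((exp ℝ - 1) ^ (j + 1) + (exp ℝ - 1) ^ j) := by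
        rw [Derivation.leibniz_pow]
        simp only [map_sub, derivative_exp, Derivation.map_one_eq_zero, nsmul_eq_mul,
          smul_eq_mul, Nat.add_sub_cancel]
        ring
      have h := congrArg (coeff n) hd
      rw [coeff_derivative, ← nsmul_eq_mul, map_nsmul, map_add, ih, ih, nsmul_eq_mul] at h
      have hn : (n : ℝ) + 1 ≠ 0 := by positivity
      have hf : (n.factorial : ℝ) ≠ 0 := by positivity
      rw [← mul_right_cancel_iff_of_pos (show (0 : ℝ) < n + 1 by positivity), h,
        Nat.stirlingSecond_succ_succ, Nat.factorial_succ, Nat.factorial_succ]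
      push_cast
      field_simp

theorem Ring.sum_range_choose_mul_neg_one_pow (r : ℝ) (m : ℕ) :
    ∑ l ∈ Finset.range (m + 1), Ring.choose r l * (-1) ^ l =
      (-1) ^ m * Ring.choose (r - 1) m := by
  induction m with
  | zero => simp
  | succ m ih =>
    rw [Finset.sum_range_succ, ih]
    have h := Ring.choose_succ_succ (r - 1) m
    rw [sub_add_cancel] at h
    rw [h]
    ring

theorem Ring.choose_neg_real (r : ℝ) (n : ℕ) :
    Ring.choose (-r) n = (-1) ^ n * Ring.choose (r + n - 1) n := by
  rw [Ring.choose_neg, Int.negOnePow_def]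
  simp [Units.smul_def]

/-- The coefficient of `X ^ n` in the formal power `A ^ r`, where `A` has constant coefficient `1`,
rewritten in terms of the powers of `A` with natural exponent. -/
theorem sum_choose_mul_coeff_sub_one_pow (A : ℝ⟦X⟧) (r : ℝ) (n : ℕ) :
    ∑ j ∈ Finset.range (n + 1), Ring.choose r j * coeff n ((A - 1) ^ j) =
      ∑ i ∈ Finset.range (n + 1),
        Ring.choose r i * Ring.choose (n - r) (n - i) * coeff n (A ^ i) := by
  have h1 (j : ℕ) : coeff n ((A - 1) ^ j) =
      ∑ i ∈ Finset.range (j + 1), (-1) ^ (j - i) * (j.choose i : ℝ) * coeff n (A ^ i) := by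
    rw [sub_eq_add_neg, add_pow, map_sum]
    refine Finset.sum_congr rfl fun i _ => ?_
    have : A ^ i * (-1) ^ (j - i) * (j.choose i : ℝ⟦X⟧) =
        ((-1) ^ (j - i) * (j.choose i : ℝ)) • A ^ i := by
      rw [smul_eq_C_mul]
      simp
      ring
    rw [this, coeff_smul, smul_eq_mul]
  simp_rw [h1, Finset.mul_sum]
  simp only [Finset.range_eq_Ico]
  rw [← Finset.sum_Ico_Ico_comm 0 (n + 1)
    (fun i j => Ring.choose r j * ((-1) ^ (j - i) * (j.choose i : ℝ) * coeff n (A ^ i)))]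
  refine Finset.sum_congr rfl fun i hi => ?_
  have hin : i ≤ n := by simp at hi; omega
  rw [Finset.sum_Ico_eq_sum_range]
  have h2 (l : ℕ) : Ring.choose r (i + l) *
      ((-1) ^ (i + l - i) * ((i + l).choose i : ℝ) * coeff n (A ^ i)) =
      (Ring.choose r i * coeff n (A ^ i)) * (Ring.choose (r - i) l * (-1) ^ l) := by
    have := Ring.choose_smul_choose r (Nat.le_add_right i l)
    rw [Nat.add_sub_cancel_left, nsmul_eq_mul] at this
    rw [Nat.add_sub_cancel_left]
    linear_combination (-1) ^ l * coeff n (A ^ i) * this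
  simp_rw [h2]
  -- The alternating sum over l collapses to one binomial coefficient, and upper negation turns r -
  -- i - 1 into n - r.
  rw [← Finset.mul_sum, show n + 1 - i = (n - i) + 1 by omega,
    Ring.sum_range_choose_mul_neg_one_pow, show r - i - 1 = -((i : ℝ) + 1 - r) by ring,
    Ring.choose_neg_real, ← mul_assoc ((-1 : ℝ) ^ _), ← mul_pow, Nat.cast_sub hin]
  norm_num
  rw [show (i : ℝ) + 1 - r + (n - i) - 1 = n - r by ring]
  ring

/-- The power series of `2 * (exp t - 1 - t) / t ^ 2`. -/
noncomputable def expRemainderSeries : PowerSeries ℝ :=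
  PowerSeries.mk fun m => 2 / ((m + 2).factorial : ℝ)

theorem X_sq_mul_expRemainderSeries :
    X ^ 2 * expRemainderSeries = C (2 : ℝ) * (exp ℝ - 1 - X) := by
  ext n
  rcases n with _ | _ | n
  · simp [coeff_zero_eq_constantCoeff]
  · rw [coeff_X_pow_mul', coeff_C_mul]
    simp [coeff_one, coeff_X, coeff_exp]
  · rw [show n + 1 + 1 = n + 2 from rfl, coeff_X_pow_mul, coeff_C_mul]
    simp [coeff_one, coeff_X, coeff_exp, expRemainderSeries]
    rfl

/-- Multiplying by X^{2i} clears the denominator, leaving 2^i ((e^X - 1) - X)^i for the binomial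
theorem; the factor X^{i-j} shifts the index n + 2i to n + i + j. -/
theorem coeff_expRemainderSeries_pow (n i : ℕ) :
    coeff n (expRemainderSeries ^ i) = 2 ^ i * ∑ j ∈ Finset.range (i + 1),
      (i.choose j : ℝ) * (-1) ^ (i - j) * (j.factorial : ℝ) *
        ((Nat.stirlingSecond (n + i + j) j : ℝ) / ((n + i + j).factorial : ℝ)) := by
  have h : X ^ (2 * i) * expRemainderSeries ^ i = C ((2 : ℝ) ^ i) *
      ∑ j ∈ Finset.range (i + 1),
        X ^ (i - j) * (((i.choose j : ℝ) * (-1) ^ (i - j)) • (exp ℝ - 1) ^ j) := by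
    rw [pow_mul, ← mul_pow, X_sq_mul_expRemainderSeries, mul_pow, ← map_pow, sub_eq_add_neg,
      add_pow]
    congr 1
    refine Finset.sum_congr rfl fun j _ => ?_
    rw [smul_eq_C_mul, neg_pow]
    simp
    ring
  rw [← coeff_X_pow_mul (expRemainderSeries ^ i) (2 * i) n, h, coeff_C_mul, map_sum]
  congr 1
  refine Finset.sum_congr rfl fun j hj => ?_
  have hj' : j ≤ i := by simp at hj; omega
  rw [show n + 2 * i = (n + i + j) + (i - j) by omega, coeff_X_pow_mul, coeff_smul, smul_eq_mul,
    coeff_exp_sub_one_pow]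
  ring

/-- Both sides have the same ratio of consecutive terms in j. This is what makes the moment sum a
binomial series with exponent -(k + 1/2). -/
theorem gaussianMoment_mul_neg_half_pow (k j : ℕ) :
    (-1 / 2 : ℝ) ^ j / (j.factorial : ℝ) *
      (((2 * (k + j)).factorial : ℝ) / (2 ^ (k + j) * ((k + j).factorial : ℝ))) =
    ((2 * k).factorial : ℝ) / (2 ^ k * (k.factorial : ℝ)) *
      Ring.choose (-((k : ℝ) + 1 / 2)) j := by
  induction j with
  | zero => simp
  | succ j ih =>
    have h := Ring.choose_smul_choose (-((k : ℝ) + 1 / 2)) (Nat.le_add_right j 1)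
    rw [Nat.add_sub_cancel_left, Ring.choose_one_right, Nat.choose_succ_self_right,
      nsmul_eq_mul] at h
    have hc : Ring.choose (-((k : ℝ) + 1 / 2)) (j + 1) =
        Ring.choose (-((k : ℝ) + 1 / 2)) j * (-((k : ℝ) + 1 / 2) - j) / (j + 1) := by
      rw [← h]
      push_cast
      field_simp
    rw [hc, mul_div_assoc, ← mul_assoc, ← ih, show 2 * (k + (j + 1)) = 2 * (k + j) + 1 + 1 by ring,
      ← add_assoc k j 1, Nat.factorial_succ (2 * (k + j) + 1), Nat.factorial_succ (2 * (k + j)),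
      Nat.factorial_succ (k + j), Nat.factorial_succ j]
    push_cast
    have h1 : (k : ℝ) + j + 1 ≠ 0 := by positivity
    field_simp
    ring

/-- The closed form of the Stirling coefficients agrees with the one obtained by integrating
the expansion of the exponential of a perturbed quadratic against the Gaussian weight. -/
theorem sum_gaussianMoment_mul_coeff (k : ℕ) :
    ∑ j ∈ Finset.range (2 * k + 1), (-1 / 2 : ℝ) ^ j / (j.factorial : ℝ) *
      (((2 * (k + j)).factorial : ℝ) / (2 ^ (k + j) * ((k + j).factorial : ℝ))) *
      coeff (2 * k) ((expRemainderSeries - 1) ^ j) =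
    ((2 * k).factorial : ℝ) / (2 ^ k * (k.factorial : ℝ)) *
        ∑ i ∈ Finset.range (2 * k + 1),
          Ring.choose ((k : ℝ) + (i : ℝ) - 1 / 2) i *
          Ring.choose (3 * (k : ℝ) + 1 / 2) (2 * k - i) * 2 ^ i *
          ∑ j ∈ Finset.range (i + 1),
            (i.choose j : ℝ) * (-1) ^ j * (j.factorial : ℝ) *
              ((Nat.stirlingSecond (2 * k + i + j) j : ℝ) /
                ((2 * k + i + j).factorial : ℝ)) := by
  simp_rw [gaussianMoment_mul_neg_half_pow, mul_assoc, ← Finset.mul_sum]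
  rw [sum_choose_mul_coeff_sub_one_pow]
  congr 1
  refine Finset.sum_congr rfl fun i hi => ?_
  rw [Ring.choose_neg_real, coeff_expRemainderSeries_pow,
    show (k : ℝ) + 1 / 2 + i - 1 = k + (i - 1 / 2) by ring,
    show ((2 * k : ℕ) : ℝ) - -(k + 1 / 2) = 3 * k + 1 / 2 by push_cast; ring, add_sub_assoc]
  simp only [Finset.mul_sum]
  refine Finset.sum_congr rfl fun j hj => ?_
  have hj' : j ≤ i := by simp at hj; omega
  have hs : (-1 : ℝ) ^ i * (-1) ^ (i - j) = (-1) ^ j := by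
    obtain ⟨l, rfl⟩ := Nat.exists_eq_add_of_le hj'
    rw [Nat.add_sub_cancel_left, pow_add, mul_assoc, ← mul_pow]
    simp
  rw [← hs]
  ring

/-! ### Taylor expansions at 0 -/

/-- The function `f` has the Taylor expansion `A` at `0`. -/
def HasTaylorExpansion (f : ℝ → ℝ) (A : PowerSeries ℝ) : Prop :=
  ∀ M : ℕ, (fun t => f t - (trunc M A).eval t) =O[𝓝 0] (fun t : ℝ => t ^ M)

theorem Polynomial.eval_isBigO_pow_of_X_pow_dvd {p : Polynomial ℝ} {M : ℕ}
    (h : Polynomial.X ^ M ∣ p) : (fun t => p.eval t) =O[𝓝 0] (fun t : ℝ => t ^ M) := by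
  obtain ⟨q, rfl⟩ := h
  have hq : (fun t => q.eval t) =O[𝓝 0] (fun _ : ℝ => (1 : ℝ)) :=
    q.continuous.continuousAt.isBigO_one ℝ
  simpa using (isBigO_refl (fun t : ℝ => t ^ M) (𝓝 0)).mul hq

namespace HasTaylorExpansion

variable {f g : ℝ → ℝ} {A B : PowerSeries ℝ}

theorem isBigO_one (hf : HasTaylorExpansion f A) : f =O[𝓝 0] (fun _ : ℝ => (1 : ℝ)) := by
  simpa using hf 0

theorem one : HasTaylorExpansion (fun _ => 1) 1 := by
  intro M
  rcases M with _ | M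
  · simpa using isBigO_refl (fun _ : ℝ => (1 : ℝ)) (𝓝 0)
  · simpa using isBigO_zero _ _

theorem sub (hf : HasTaylorExpansion f A) (hg : HasTaylorExpansion g B) :
    HasTaylorExpansion (fun t => f t - g t) (A - B) := by
  intro M
  refine ((hf M).sub (hg M)).congr_left fun t => ?_
  rw [map_sub, Polynomial.eval_sub]
  ring

theorem mul (hf : HasTaylorExpansion f A) (hg : HasTaylorExpansion g B) :
    HasTaylorExpansion (fun t => f t * g t) (A * B) := by
  intro M
  have h1 := (hf M).mul hg.isBigO_one
  have hT : (fun t => (trunc M A).eval t) =O[𝓝 0] (fun _ : ℝ => (1 : ℝ)) :=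
    (trunc M A).continuous.continuousAt.isBigO_one ℝ
  have h2 := hT.mul (hg M)
  have h3 : (fun t => (trunc M A * trunc M B - trunc M (A * B)).eval t)
      =O[𝓝 0] (fun t : ℝ => t ^ M) := by
    apply Polynomial.eval_isBigO_pow_of_X_pow_dvd
    rw [Polynomial.X_pow_dvd_iff]
    intro d hd
    rw [Polynomial.coeff_sub, coeff_trunc, if_pos hd, coeff_mul_eq_coeff_trunc_mul_trunc A B hd,
      ← Polynomial.coe_mul, Polynomial.coeff_coe, sub_self]
  simp only [mul_one, one_mul] at h1 h2
  refine ((h1.add h2).add h3).congr_left fun t => ?_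
  rw [Polynomial.eval_sub, Polynomial.eval_mul]
  ring

theorem pow (hf : HasTaylorExpansion f A) (j : ℕ) :
    HasTaylorExpansion (fun t => f t ^ j) (A ^ j) := by
  induction j with
  | zero => simpa using one
  | succ j ih => simpa only [pow_succ] using ih.mul hf

end HasTaylorExpansion

theorem abs_exp_sub_sum_le (x : ℝ) (n : ℕ) :
    |Real.exp x - ∑ m ∈ Finset.range n, x ^ m / (m.factorial : ℝ)| ≤ |x| ^ n * Real.exp |x| := by
  have h := Complex.norm_exp_sub_sum_le_norm_mul_exp (x : ℂ) n
  rw [Complex.norm_real, Real.norm_eq_abs, ← Complex.ofReal_exp] at h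
  rw [← Real.norm_eq_abs, ← Complex.norm_real]
  push_cast
  simpa using h

/-- The function `2 * (exp t - 1 - t) / t ^ 2`, extended by continuity to `t = 0`. -/
noncomputable def expRemainder (t : ℝ) : ℝ :=
  if t = 0 then 1 else 2 * (Real.exp t - 1 - t) / t ^ 2

theorem sq_mul_expRemainder (t : ℝ) : t ^ 2 * expRemainder t = 2 * (Real.exp t - 1 - t) := by
  unfold expRemainder
  split_ifs with h
  · simp [h]
  · field_simp

theorem hasTaylorExpansion_expRemainder :
    HasTaylorExpansion expRemainder expRemainderSeries := by
  intro M
  have hb : ∀ t : ℝ, t ^ 2 * (expRemainder t - (trunc M expRemainderSeries).eval t) =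
      2 * (Real.exp t - ∑ m ∈ Finset.range (M + 2), t ^ m / (m.factorial : ℝ)) := by
    intro t
    rw [mul_sub, sq_mul_expRemainder, ← Polynomial.eval₂_id, eval₂_trunc_eq_sum_range,
      Finset.sum_range_succ', Finset.sum_range_succ', Finset.mul_sum]
    have : ∑ m ∈ Finset.range M, t ^ (m + 1 + 1) / ((m + 1 + 1).factorial : ℝ) =
        (∑ m ∈ Finset.range M, t ^ 2 * (RingHom.id ℝ (coeff m expRemainderSeries) * t ^ m)) / 2 := by
      rw [Finset.sum_div]
      refine Finset.sum_congr rfl fun m _ => ?_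
      rw [expRemainderSeries, coeff_mk, RingHom.id_apply]
      field_simp
      ring
    rw [this]
    simp
    ring
  refine IsBigO.of_bound (2 * Real.exp 1) ?_
  have hball : ∀ᶠ t : ℝ in 𝓝 0, |t| < 1 := by
    filter_upwards [Metric.ball_mem_nhds (0 : ℝ) one_pos] with t ht
    simpa using ht
  filter_upwards [hball] with t ht
  rw [norm_pow, Real.norm_eq_abs, Real.norm_eq_abs]
  rcases eq_or_ne t 0 with rfl | h0
  -- At t = 0 the factor t² cannot be cancelled; M = 0 is separate because 0^0 = 1.
  · rcases M with _ | M
    · simp only [expRemainder, if_true, trunc_zero', Polynomial.eval_zero]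
      simp only [sub_zero, abs_one, pow_zero, mul_one]
      linarith [Real.add_one_le_exp 1]
    · simp [expRemainder, ← Polynomial.coeff_zero_eq_eval_zero, coeff_trunc, expRemainderSeries]
  · have h1 := abs_exp_sub_sum_le t (M + 2)
    have h2 := congrArg abs (hb t)
    rw [abs_mul, abs_mul, abs_pow, abs_two] at h2
    have hpos : 0 < |t| ^ 2 := by positivity
    refine le_of_mul_le_mul_left ?_ hpos
    have hexp : Real.exp |t| ≤ Real.exp 1 := Real.exp_le_exp.2 ht.le
    calc _ ≤ 2 * (|t| ^ (M + 2) * Real.exp 1) := by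
          rw [h2]; gcongr; exact h1.trans (by gcongr)
      _ = |t| ^ 2 * (2 * Real.exp 1 * |t| ^ M) := by ring

/-! ### Uniform bounds for the perturbed Gaussian -/

/-- The expansion to order `M` of `exp (-x ^ 2 / 2 * (expRemainder t - 1))` in powers of `t`. -/
noncomputable def gaussianCorrection (M : ℕ) (t x : ℝ) : ℝ :=
  ∑ j ∈ Finset.range M, (-x ^ 2 / 2) ^ j / (j.factorial : ℝ) *
    (trunc M ((expRemainderSeries - 1) ^ j)).eval t

theorem sq_div_two_pow_le (x : ℝ) {j M : ℕ} (h : j ≤ M) : (x ^ 2 / 2) ^ j ≤ (1 + x ^ 2) ^ M := by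
  have h0 := sq_nonneg x
  calc (x ^ 2 / 2) ^ j ≤ (1 + x ^ 2) ^ j := by gcongr; linarith
    _ ≤ (1 + x ^ 2) ^ M := pow_le_pow_right₀ (by linarith) h

/-- For small t, |R(t) - 1| ≤ L|t| ≤ 1/2, so the exponent is at most x²/4 in absolute value and
costs only half of the Gaussian decay. The error is the exponential remainder plus the Taylor
remainders of (R - 1)^j. -/
theorem exists_abs_exp_sub_gaussianCorrection_le (M : ℕ) :
    ∃ δ : ℝ, 0 < δ ∧ δ ≤ 1 ∧ ∃ C : ℝ, 0 ≤ C ∧ ∀ t x : ℝ, |t| ≤ δ →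
      |Real.exp (-x ^ 2 / 2 * (expRemainder t - 1)) - gaussianCorrection M t x| ≤
        C * |t| ^ M * (1 + x ^ 2) ^ M * Real.exp (x ^ 2 / 4) := by
  have hT : HasTaylorExpansion (fun t => expRemainder t - 1) (expRemainderSeries - 1) :=
    hasTaylorExpansion_expRemainder.sub .one
  have hpow (j : ℕ) := hT.pow j M
  choose K hK using fun j => (hpow j).exists_pos
  have hlin : (fun t => expRemainder t - 1) =O[𝓝 0] (fun t : ℝ => t) := by
    have h1 := hT 1
    have : trunc 1 (expRemainderSeries - 1) = 0 := by
      ext n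
      rw [coeff_trunc]
      split_ifs with hn
      · obtain rfl : n = 0 := by omega
        rw [map_sub, expRemainderSeries, coeff_mk]
        simp
      · simp
    simpa [this] using h1
  obtain ⟨L, hL0, hL⟩ := hlin.exists_pos
  have hev : ∀ᶠ t : ℝ in 𝓝 0, |expRemainder t - 1| ≤ L * |t| ∧ L * |t| ≤ 1 / 2 ∧
      ∀ j ∈ Finset.range M, |(expRemainder t - 1) ^ j -
        (trunc M ((expRemainderSeries - 1) ^ j)).eval t| ≤ K j * |t| ^ M := by
    refine hL.bound.and (Filter.Eventually.and ?_ ?_)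
    · have : Tendsto (fun t : ℝ => L * |t|) (𝓝 0) (𝓝 (L * |0|)) :=
        (continuous_const.mul continuous_abs).tendsto 0
      rw [abs_zero, mul_zero] at this
      exact this.eventually_le_const (by norm_num)
    · rw [Filter.eventually_all_finset]
      intro j _
      filter_upwards [(hK j).2.bound] with t ht
      simpa using ht
  obtain ⟨δ, hδ, hball⟩ := Metric.eventually_nhds_iff.1 hev
  refine ⟨min (δ / 2) 1, by positivity, min_le_right _ _, L ^ M + ∑ j ∈ Finset.range M, K j, ?_, ?_⟩
  · have : 0 ≤ ∑ j ∈ Finset.range M, K j := Finset.sum_nonneg fun j _ => (hK j).1.le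
    positivity
  intro t x ht
  obtain ⟨h1, h2, h3⟩ := hball (y := t) (by
    rw [Real.dist_eq, sub_zero]
    have := ht.trans (min_le_left _ _)
    linarith)
  set h := expRemainder t - 1 with hh
  have hx := sq_nonneg x
  have hy : |-x ^ 2 / 2 * h| ≤ x ^ 2 / 2 * (L * |t|) := by
    rw [abs_mul, neg_div, abs_neg, abs_of_nonneg (by positivity : 0 ≤ x ^ 2 / 2)]
    gcongr
  have hy4 : |-x ^ 2 / 2 * h| ≤ x ^ 2 / 4 := by
    have := mul_le_mul_of_nonneg_left h2 (by positivity : 0 ≤ x ^ 2 / 2)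
    linarith
  have hexp1 : 1 ≤ Real.exp (x ^ 2 / 4) := Real.one_le_exp (by positivity)
  have hA : |Real.exp (-x ^ 2 / 2 * h) - ∑ j ∈ Finset.range M,
      (-x ^ 2 / 2 * h) ^ j / (j.factorial : ℝ)| ≤
      L ^ M * |t| ^ M * (1 + x ^ 2) ^ M * Real.exp (x ^ 2 / 4) := by
    calc _ ≤ |-x ^ 2 / 2 * h| ^ M * Real.exp |-x ^ 2 / 2 * h| := abs_exp_sub_sum_le _ _
      _ ≤ (x ^ 2 / 2 * (L * |t|)) ^ M * Real.exp (x ^ 2 / 4) := by gcongr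
      _ = L ^ M * |t| ^ M * (x ^ 2 / 2) ^ M * Real.exp (x ^ 2 / 4) := by ring
      _ ≤ _ := by gcongr; linarith
  have hB : |(∑ j ∈ Finset.range M, (-x ^ 2 / 2 * h) ^ j / (j.factorial : ℝ)) -
      gaussianCorrection M t x| ≤
      (∑ j ∈ Finset.range M, K j) * |t| ^ M * (1 + x ^ 2) ^ M * Real.exp (x ^ 2 / 4) := by
    rw [gaussianCorrection, ← Finset.sum_sub_distrib]
    simp only [Finset.sum_mul]
    refine (Finset.abs_sum_le_sum_abs _ _).trans (Finset.sum_le_sum fun j hj => ?_)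
    have e : (-x ^ 2 / 2 * h) ^ j / (j.factorial : ℝ) - (-x ^ 2 / 2) ^ j / (j.factorial : ℝ) *
        (trunc M ((expRemainderSeries - 1) ^ j)).eval t =
        (-x ^ 2 / 2) ^ j / (j.factorial : ℝ) *
          (h ^ j - (trunc M ((expRemainderSeries - 1) ^ j)).eval t) := by rw [mul_pow]; ring
    have hf : (1 : ℝ) ≤ j.factorial := by exact_mod_cast j.factorial_pos
    have hc : |(-x ^ 2 / 2) ^ j / (j.factorial : ℝ)| ≤ (1 + x ^ 2) ^ M := by
      rw [abs_div, abs_pow, neg_div, abs_neg, abs_of_nonneg (by positivity : 0 ≤ x ^ 2 / 2),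
        abs_of_nonneg (by positivity : (0 : ℝ) ≤ j.factorial)]
      exact (div_le_self (by positivity) hf).trans
        (sq_div_two_pow_le x (Finset.mem_range.1 hj).le)
    rw [e, abs_mul]
    have hKj := (hK j).1
    calc _ ≤ (1 + x ^ 2) ^ M * (K j * |t| ^ M) := by gcongr; exact h3 j hj
      _ = K j * |t| ^ M * (1 + x ^ 2) ^ M * 1 := by ring
      _ ≤ _ := by gcongr
  calc _ ≤ _ := abs_sub_le _ (∑ j ∈ Finset.range M, (-x ^ 2 / 2 * h) ^ j / (j.factorial : ℝ)) _
    _ ≤ _ := add_le_add hA hB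
    _ = _ := by ring

/-- Away from 0 no cancellation is needed: since |t|/δ ≥ 1, each |t|^m with m < M is at most
(|t|/δ)^M. -/
theorem exists_abs_gaussianCorrection_le (M : ℕ) {δ : ℝ} (hδ : 0 < δ) (hδ1 : δ ≤ 1) :
    ∃ C : ℝ, 0 ≤ C ∧ ∀ t x : ℝ, δ ≤ |t| →
      |gaussianCorrection M t x| ≤ C * |t| ^ M * (1 + x ^ 2) ^ M := by
  refine ⟨∑ j ∈ Finset.range M, ∑ m ∈ Finset.range M,
    |coeff m ((expRemainderSeries - 1) ^ j)| * (1 / δ) ^ M, by positivity, fun t x ht => ?_⟩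
  simp only [gaussianCorrection, Finset.sum_mul]
  refine (Finset.abs_sum_le_sum_abs _ _).trans (Finset.sum_le_sum fun j hj => ?_)
  have hf : (1 : ℝ) ≤ j.factorial := by exact_mod_cast j.factorial_pos
  have hc : |(-x ^ 2 / 2) ^ j / (j.factorial : ℝ)| ≤ (1 + x ^ 2) ^ M := by
    rw [abs_div, abs_pow, neg_div, abs_neg, abs_of_nonneg (by positivity : 0 ≤ x ^ 2 / 2),
      abs_of_nonneg (by positivity : (0 : ℝ) ≤ j.factorial)]
    exact (div_le_self (by positivity) hf).trans
      (sq_div_two_pow_le x (Finset.mem_range.1 hj).le)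
  rw [abs_mul, ← Polynomial.eval₂_id, eval₂_trunc_eq_sum_range, mul_comm]
  simp only [← Finset.sum_mul]
  gcongr
  simp only [Finset.sum_mul]
  refine (Finset.abs_sum_le_sum_abs _ _).trans (Finset.sum_le_sum fun m hm => ?_)
  rw [RingHom.id_apply, abs_mul, mul_assoc, abs_pow]
  gcongr
  have h1 : 1 ≤ 1 / δ * |t| := by
    rw [one_div, inv_mul_eq_div, one_le_div hδ]
    exact ht
  have hm' := (Finset.mem_range.1 hm).le
  calc |t| ^ m = δ ^ m * (1 / δ * |t|) ^ m := by rw [← mul_pow]; congr 1; field_simp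
    _ ≤ 1 * (1 / δ * |t|) ^ M := by
      gcongr
      exact pow_le_one₀ hδ.le hδ1
    _ = _ := by rw [one_mul, mul_pow]

/-- For s ≥ -2, square e^{s/2} ≥ 1 + s/2; for s ≤ -2, e^s > 0 suffices. -/
theorem exp_sub_one_sub_lower_bound (s : ℝ) :
    min (s ^ 2 / 4) (|s| / 2) ≤ Real.exp s - 1 - s := by
  rcases le_total (-2) s with h | h
  · refine (min_le_left _ _).trans ?_
    have h1 := Real.add_one_le_exp (s / 2)
    have h2 : Real.exp s = Real.exp (s / 2) ^ 2 := by
      rw [← Real.exp_nat_mul]; congr 1; push_cast; ring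
    have h3 : (s / 2 + 1) ^ 2 ≤ Real.exp (s / 2) ^ 2 := by gcongr; linarith
    rw [h2]
    linarith
  · refine (min_le_right _ _).trans ?_
    rw [abs_of_nonpos (by linarith)]
    linarith [Real.exp_pos s]

/-! ### The phase and its Gaussian approximation -/

/-- The exponent in the Gamma integral after centering and rescaling at its saddle point. -/
noncomputable def gammaPhase (n : ℕ) (x : ℝ) : ℝ :=
  n * (Real.exp (x / √n) - 1 - x / √n)

theorem gammaPhase_eq {n : ℕ} (hn : n ≠ 0) (x : ℝ) :
    gammaPhase n x = x ^ 2 / 2 * expRemainder (x / √n) := by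
  have hn' : (0 : ℝ) < n := by positivity
  have h := sq_mul_expRemainder (x / √n)
  rw [div_pow, Real.sq_sqrt hn'.le] at h
  have h' : Real.exp (x / √n) - 1 - x / √n = x ^ 2 / n * expRemainder (x / √n) / 2 := by linarith
  rw [gammaPhase, h']
  field_simp

/-- A bound free of n, hence an integrable majorant common to all n ≥ 1. The 1/4 absorbs x²/4 <
|x|/2 for small x, by (|x| - 1)² ≥ 0. -/
theorem gammaPhase_lower_bound {n : ℕ} (hn : n ≠ 0) (x : ℝ) :
    |x| / 2 - 1 / 4 ≤ gammaPhase n x := by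
  have hn1 : (1 : ℝ) ≤ n := by exact_mod_cast Nat.one_le_iff_ne_zero.2 hn
  have hs1 : 1 ≤ √(n : ℝ) := Real.one_le_sqrt.2 hn1
  have hsq : √(n : ℝ) * √(n : ℝ) = n := Real.mul_self_sqrt (by linarith)
  have hb := mul_le_mul_of_nonneg_left (exp_sub_one_sub_lower_bound (x / √n))
    (by linarith : (0 : ℝ) ≤ n)
  refine le_trans ?_ hb
  rw [mul_min_of_nonneg _ _ (by linarith), div_pow, Real.sq_sqrt (by linarith), abs_div,
    abs_of_nonneg (Real.sqrt_nonneg _)]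
  have e1 : (n : ℝ) * (x ^ 2 / n / 4) = x ^ 2 / 4 := by field_simp
  have e2 : (n : ℝ) * (|x| / √n / 2) = √n * |x| / 2 := by
    nth_rewrite 1 [← hsq]
    field_simp
  rw [e1, e2]
  refine le_min ?_ ?_
  · nlinarith [sq_nonneg (|x| - 1), sq_abs x]
  · nlinarith [abs_nonneg x]

theorem exp_neg_sq_div_four_le (x : ℝ) :
    Real.exp (-x ^ 2 / 4) ≤ Real.exp (1 / 4) * Real.exp (-|x| / 2) := by
  rw [← Real.exp_add]
  refine Real.exp_le_exp.2 ?_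
  nlinarith [sq_nonneg (|x| - 1), sq_abs x]

theorem exp_neg_gammaPhase_le {n : ℕ} (hn : n ≠ 0) (x : ℝ) :
    Real.exp (-gammaPhase n x) ≤ Real.exp (1 / 4) * Real.exp (-|x| / 2) := by
  rw [← Real.exp_add]
  refine Real.exp_le_exp.2 ?_
  linarith [gammaPhase_lower_bound hn x]

theorem exists_pow_mul_exp_neg_abs_le (M : ℕ) : ∃ C : ℝ, ∀ x : ℝ,
    |x| ^ M * (1 + x ^ 2) ^ M * Real.exp (-|x| / 2) ≤ C * (1 + x ^ 2)⁻¹ := by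
  -- The exponent 3M + 2 is the total degree M + 2M + 2 in 1 + |x|; apply y^p/p! ≤ e^y at y = (1 +
  -- |x|)/2.
  refine ⟨2 ^ (3 * M + 2) * ((3 * M + 2).factorial * Real.exp (1 / 2)), fun x => ?_⟩
  rw [← div_eq_mul_inv, le_div_iff₀ (by positivity)]
  have h0 := abs_nonneg x
  have h1 : 1 + x ^ 2 ≤ (1 + |x|) ^ 2 := by nlinarith [sq_abs x]
  have h2 : ((1 + |x|) / 2) ^ (3 * M + 2) / (3 * M + 2).factorial ≤ Real.exp ((1 + |x|) / 2) :=
    Real.pow_div_factorial_le_exp _ (by positivity) _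
  rw [div_le_iff₀ (by positivity)] at h2
  calc _ ≤ (1 + |x|) ^ M * ((1 + |x|) ^ 2) ^ M * Real.exp (-|x| / 2) * (1 + |x|) ^ 2 := by
        gcongr; linarith
    _ = 2 ^ (3 * M + 2) * (((1 + |x|) / 2) ^ (3 * M + 2)) * Real.exp (-|x| / 2) := by
        rw [← mul_pow 2, mul_div_cancel₀ _ two_ne_zero]; generalize 1 + |x| = y; ring
    _ ≤ 2 ^ (3 * M + 2) * (Real.exp ((1 + |x|) / 2) * (3 * M + 2).factorial) *
          Real.exp (-|x| / 2) := by gcongr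
    _ = 2 ^ (3 * M + 2) * ((3 * M + 2).factorial *
          (Real.exp ((1 + |x|) / 2) * Real.exp (-|x| / 2))) := by ring
    _ = _ := by rw [← Real.exp_add]; congr 3; ring_nf

/-- For |t| ≤ δ the local expansion applies. For |t| ≥ δ both terms are bounded separately, and
(|t|/δ)^M ≥ 1 supplies the factor n^{-M/2}. -/
theorem exists_abs_exp_neg_gammaPhase_sub_le (M : ℕ) : ∃ C : ℝ, ∀ n : ℕ, n ≠ 0 → ∀ x : ℝ,
    |Real.exp (-gammaPhase n x) - Real.exp (-x ^ 2 / 2) * gaussianCorrection M (x / √n) x| ≤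
      C * (1 / √n) ^ M * (1 + x ^ 2)⁻¹ := by
  obtain ⟨δ, hδ, hδ1, C₁, hC₁, h₁⟩ := exists_abs_exp_sub_gaussianCorrection_le M
  obtain ⟨C₂, hC₂, h₂⟩ := exists_abs_gaussianCorrection_le M hδ hδ1
  obtain ⟨C₃, h₃⟩ := exists_pow_mul_exp_neg_abs_le M
  set C := max C₁ ((1 / δ) ^ M + C₂) with hC
  have hC0 : 0 ≤ C := hC₁.trans (le_max_left _ _)
  refine ⟨C * Real.exp (1 / 4) * C₃, fun n hn x => ?_⟩
  have hn' : (0 : ℝ) < n := by positivity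
  set t := x / √(n : ℝ) with ht
  have habs : |t| ^ M = (1 / √n) ^ M * |x| ^ M := by
    rw [ht, abs_div, abs_of_nonneg (Real.sqrt_nonneg _), ← mul_pow]
    congr 1
    ring
  have hx1 : 1 ≤ (1 + x ^ 2) ^ M := one_le_pow₀ (by nlinarith [sq_nonneg x])
  suffices h : |Real.exp (-gammaPhase n x) - Real.exp (-x ^ 2 / 2) * gaussianCorrection M t x| ≤
      C * |t| ^ M * (1 + x ^ 2) ^ M * (Real.exp (1 / 4) * Real.exp (-|x| / 2)) by
    calc _ ≤ _ := h
      _ = C * Real.exp (1 / 4) * (1 / √n) ^ M *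
          (|x| ^ M * (1 + x ^ 2) ^ M * Real.exp (-|x| / 2)) := by rw [habs]; ring
      _ ≤ C * Real.exp (1 / 4) * (1 / √n) ^ M * (C₃ * (1 + x ^ 2)⁻¹) :=
        mul_le_mul_of_nonneg_left (h₃ x) (by positivity)
      _ = _ := by ring
  rcases le_total |t| δ with hle | hge
  · have hsplit : Real.exp (-gammaPhase n x) =
        Real.exp (-x ^ 2 / 2) * Real.exp (-x ^ 2 / 2 * (expRemainder t - 1)) := by
      rw [gammaPhase_eq hn, ← Real.exp_add]
      congr 1
      ring
    rw [hsplit, ← mul_sub, abs_mul, Real.abs_exp]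
    calc _ ≤ Real.exp (-x ^ 2 / 2) *
          (C₁ * |t| ^ M * (1 + x ^ 2) ^ M * Real.exp (x ^ 2 / 4)) := by gcongr; exact h₁ t x hle
      _ = C₁ * |t| ^ M * (1 + x ^ 2) ^ M * Real.exp (-x ^ 2 / 4) := by
        rw [show -x ^ 2 / 4 = -x ^ 2 / 2 + x ^ 2 / 4 by ring, Real.exp_add]; ring
      _ ≤ _ := by
        gcongr
        · exact le_max_left _ _
        · exact exp_neg_sq_div_four_le x
  · have hE := exp_neg_gammaPhase_le hn x
    have hG : Real.exp (-x ^ 2 / 2) ≤ Real.exp (1 / 4) * Real.exp (-|x| / 2) := by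
      refine le_trans (Real.exp_le_exp.2 ?_) (exp_neg_sq_div_four_le x)
      nlinarith [sq_nonneg x]
    have h1 : 1 ≤ (1 / δ) ^ M * |t| ^ M := by
      rw [← mul_pow]
      refine one_le_pow₀ ?_
      rw [one_div, inv_mul_eq_div, one_le_div hδ]
      exact hge
    calc _ ≤ |Real.exp (-gammaPhase n x)| + |Real.exp (-x ^ 2 / 2) * gaussianCorrection M t x| :=
          abs_sub _ _
      _ = 1 * 1 * Real.exp (-gammaPhase n x) +
          Real.exp (-x ^ 2 / 2) * |gaussianCorrection M t x| := by
        rw [abs_mul, Real.abs_exp, Real.abs_exp]; ring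
      _ ≤ ((1 / δ) ^ M * |t| ^ M) * (1 + x ^ 2) ^ M * (Real.exp (1 / 4) * Real.exp (-|x| / 2)) +
          (Real.exp (1 / 4) * Real.exp (-|x| / 2)) * (C₂ * |t| ^ M * (1 + x ^ 2) ^ M) := by
        gcongr
        exact h₂ t x hge
      _ = ((1 / δ) ^ M + C₂) * |t| ^ M * (1 + x ^ 2) ^ M *
          (Real.exp (1 / 4) * Real.exp (-|x| / 2)) := by ring
      _ ≤ _ := by gcongr; exact le_max_right _ _

/-! ### Integral representation and Gaussian moments -/

theorem factorial_eq_integral_gammaPhase {n : ℕ} (hn : n ≠ 0) :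
    (n.factorial : ℝ) =
      (n : ℝ) ^ n * Real.exp (-n) * √n * ∫ x : ℝ, Real.exp (-gammaPhase n x) := by
  have hn' : (0 : ℝ) < n := by positivity
  have hs : 0 < √(n : ℝ) := Real.sqrt_pos.2 hn'
  have himg : (fun x : ℝ => (n : ℝ) * Real.exp (x / √n)) '' Set.univ = Set.Ioi 0 := by
    ext y
    simp only [Set.image_univ, Set.mem_range, Set.mem_Ioi]
    constructor
    · rintro ⟨x, rfl⟩
      positivity
    · intro hy
      refine ⟨√n * Real.log (y / n), ?_⟩
      rw [mul_div_cancel_left₀ _ hs.ne', Real.exp_log (by positivity)]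
      field_simp
  have hderiv (x : ℝ) : HasDerivWithinAt (fun x : ℝ => (n : ℝ) * Real.exp (x / √n))
      (n * (Real.exp (x / √n) * (1 / √n))) Set.univ x :=
    ((((hasDerivAt_id x).div_const _).exp).const_mul _).hasDerivWithinAt
  have hinj : Set.InjOn (fun x : ℝ => (n : ℝ) * Real.exp (x / √n)) Set.univ := by
    intro x _ y _ hxy
    have := Real.exp_injective (mul_left_cancel₀ hn'.ne' hxy)
    exact (div_left_inj' hs.ne').1 this
  have hG := Real.Gamma_eq_integral hn'
  rw [← himg, integral_image_eq_integral_abs_deriv_smul MeasurableSet.univ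
    (fun x _ => hderiv x) hinj, setIntegral_univ] at hG
  have hint (x : ℝ) : |n * (Real.exp (x / √n) * (1 / √n))| •
      (Real.exp (-(n * Real.exp (x / √n))) * (n * Real.exp (x / √n)) ^ ((n : ℝ) - 1)) =
      (n : ℝ) ^ n * Real.exp (-n) / √n * Real.exp (-gammaPhase n x) := by
    have hpos : 0 < n * Real.exp (x / √n) := by positivity
    rw [Real.rpow_sub_one hpos.ne', Real.rpow_natCast, mul_pow, ← Real.exp_nat_mul,
      abs_of_nonneg (by positivity), smul_eq_mul]
    have : Real.exp (-(n * Real.exp (x / √n))) * Real.exp (n * (x / √n)) =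
        Real.exp (-n) * Real.exp (-gammaPhase n x) := by
      rw [← Real.exp_add, ← Real.exp_add, gammaPhase]
      congr 1
      ring
    calc _ = (n : ℝ) ^ n / √n *
        (Real.exp (-(n * Real.exp (x / √n))) * Real.exp (n * (x / √n))) := by field_simp
      _ = _ := by rw [this]; ring
  simp_rw [hint] at hG
  rw [integral_const_mul] at hG
  rw [← Real.Gamma_nat_eq_factorial, Real.Gamma_add_one hn'.ne', hG]
  have hsq : √(n : ℝ) * √n = n := Real.mul_self_sqrt hn'.le
  nth_rewrite 1 [← hsq]
  field_simp

theorem continuous_gammaPhase (n : ℕ) : Continuous (gammaPhase n) := by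
  unfold gammaPhase
  fun_prop

theorem integrable_pow_mul_exp_neg_sq_div_two (p : ℕ) :
    Integrable fun x : ℝ => x ^ p * Real.exp (-x ^ 2 / 2) := by
  have h := integrable_rpow_mul_exp_neg_mul_sq (b := 1 / 2) (by norm_num) (s := p)
    (by have : (0 : ℝ) ≤ p := p.cast_nonneg
        linarith)
  refine h.congr (Eventually.of_forall fun x => ?_)
  simp only [Real.rpow_natCast]
  congr 2
  ring

theorem integral_odd_pow_mul_exp_neg_sq_div_two {p : ℕ} (hp : Odd p) :
    ∫ x : ℝ, x ^ p * Real.exp (-x ^ 2 / 2) = 0 := by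
  have h := integral_neg_eq_self (fun x : ℝ => x ^ p * Real.exp (-x ^ 2 / 2)) volume
  simp only [hp.neg_pow, neg_sq, neg_mul, integral_neg] at h
  linarith

theorem Gamma_nat_add_half_eq (p : ℕ) :
    Real.Gamma (p + 1 / 2) = ((2 * p).factorial : ℝ) / (4 ^ p * (p.factorial : ℝ)) * √Real.pi := by
  induction p with
  | zero => simpa using Real.Gamma_one_half_eq
  | succ p ih =>
    have h : (p : ℝ) + 1 / 2 ≠ 0 := by positivity
    rw [Nat.cast_succ, add_right_comm, Real.Gamma_add_one h, ih,
      show 2 * (p + 1) = 2 * p + 1 + 1 by ring, Nat.factorial_succ (2 * p + 1),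
      Nat.factorial_succ (2 * p), Nat.factorial_succ p]
    push_cast
    field_simp
    ring

theorem integral_even_pow_mul_exp_neg_sq_div_two (p : ℕ) :
    ∫ x : ℝ, x ^ (2 * p) * Real.exp (-x ^ 2 / 2) =
      √(2 * Real.pi) * (((2 * p).factorial : ℝ) / (2 ^ p * (p.factorial : ℝ))) := by
  have habs := integral_comp_abs (f := fun x : ℝ => x ^ (2 * p) * Real.exp (-x ^ 2 / 2))
  have hpow (x : ℝ) : |x| ^ (2 * p) = x ^ (2 * p) := by rw [pow_mul, pow_mul, sq_abs]
  simp only [hpow, sq_abs] at habs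
  have hI := integral_rpow_mul_exp_neg_mul_rpow (p := 2) (q := (2 * p : ℕ)) (b := 1 / 2)
    (by norm_num) (by have : (0 : ℝ) ≤ (2 * p : ℕ) := Nat.cast_nonneg _
                      linarith) (by norm_num)
  have hcongr : ∫ x in Set.Ioi (0 : ℝ), x ^ (2 * p) * Real.exp (-x ^ 2 / 2) =
      ∫ x in Set.Ioi (0 : ℝ), x ^ ((2 * p : ℕ) : ℝ) * Real.exp (-(1 / 2) * x ^ (2 : ℝ)) := by
    refine setIntegral_congr_fun measurableSet_Ioi fun x _ => ?_
    simp only [Real.rpow_natCast, Real.rpow_two]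
    congr 2
    ring
  have e : (((2 * p : ℕ) : ℝ) + 1) / 2 = p + 1 / 2 := by push_cast; ring
  rw [habs, hcongr, hI, neg_div, e, Gamma_nat_add_half_eq, one_div 2, Real.inv_rpow zero_le_two,
    Real.rpow_neg zero_le_two, inv_inv, Real.rpow_add two_pos, Real.rpow_natCast,
    ← one_div, ← Real.sqrt_eq_rpow, Real.sqrt_mul zero_le_two,
    show (4 : ℝ) ^ p = 2 ^ p * 2 ^ p by rw [← mul_pow]; norm_num]
  field_simp

/-! ### Termwise integration and the expansion -/

theorem coeff_expRemainderSeries_sub_one_pow_of_lt {m j : ℕ} (h : m < j) :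
    coeff m ((expRemainderSeries - 1) ^ j) = 0 := by
  have hX : X ∣ expRemainderSeries - 1 := by
    rw [X_dvd_iff, ← coeff_zero_eq_constantCoeff_apply, map_sub, expRemainderSeries, coeff_mk]
    simp
  exact X_pow_dvd_iff.1 (pow_dvd_pow_of_dvd hX j) m h

/-- The coefficients obtained by integrating the expansion of the perturbed Gaussian. -/
noncomputable def laplaceCoeff (k : ℕ) : ℝ :=
  ∑ j ∈ Finset.range (2 * k + 1), (-1 / 2 : ℝ) ^ j / (j.factorial : ℝ) *
    (((2 * (k + j)).factorial : ℝ) / (2 ^ (k + j) * ((k + j).factorial : ℝ))) *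
    coeff (2 * k) ((expRemainderSeries - 1) ^ j)

theorem exp_mul_gaussianCorrection_eq (M n : ℕ) (x : ℝ) :
    Real.exp (-x ^ 2 / 2) * gaussianCorrection M (x / √n) x =
      ∑ m ∈ Finset.range M, ∑ j ∈ Finset.range M,
        ((1 / √n) ^ m * ((-1 / 2) ^ j / (j.factorial : ℝ) *
          coeff m ((expRemainderSeries - 1) ^ j))) *
          (x ^ (m + 2 * j) * Real.exp (-x ^ 2 / 2)) := by
  rw [Finset.sum_comm, gaussianCorrection, Finset.mul_sum]
  refine Finset.sum_congr rfl fun j _ => ?_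
  rw [← Polynomial.eval₂_id, eval₂_trunc_eq_sum_range, Finset.mul_sum, Finset.mul_sum]
  refine Finset.sum_congr rfl fun m _ => ?_
  rw [RingHom.id_apply, div_eq_mul_one_div x, mul_pow x, show -x ^ 2 / 2 = -1 / 2 * x ^ 2 by ring,
    mul_pow, ← pow_mul, pow_add]
  ring

theorem integrable_exp_mul_gaussianCorrection (M n : ℕ) :
    Integrable fun x : ℝ => Real.exp (-x ^ 2 / 2) * gaussianCorrection M (x / √n) x := by
  simp_rw [exp_mul_gaussianCorrection_eq]
  exact integrable_finsetSum _ fun m _ => integrable_finsetSum _ fun j _ =>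
    (integrable_pow_mul_exp_neg_sq_div_two _).const_mul _

theorem Finset.sum_range_two_mul_add_one_of_odd_eq_zero {f : ℕ → ℝ}
    (hf : ∀ m, Odd m → f m = 0) (N : ℕ) :
    ∑ m ∈ Finset.range (2 * N + 1), f m = ∑ k ∈ Finset.range (N + 1), f (2 * k) := by
  induction N with
  | zero => simp
  | succ N ih =>
    rw [show 2 * (N + 1) + 1 = 2 * N + 1 + 1 + 1 by ring, Finset.sum_range_succ,
      Finset.sum_range_succ, ih, Finset.sum_range_succ _ (N + 1), hf _ (odd_two_mul_add_one N),
      add_zero]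
    rfl

theorem integral_exp_mul_gaussianCorrection (N n : ℕ) :
    ∫ x : ℝ, Real.exp (-x ^ 2 / 2) * gaussianCorrection (2 * N + 1) (x / √n) x =
      √(2 * Real.pi) * ∑ k ∈ Finset.range (N + 1), laplaceCoeff k / (n : ℝ) ^ k := by
  have hi (m j : ℕ) := (integrable_pow_mul_exp_neg_sq_div_two (m + 2 * j)).const_mul
    ((1 / √n) ^ m * ((-1 / 2) ^ j / (j.factorial : ℝ) * coeff m ((expRemainderSeries - 1) ^ j)))
  simp_rw [exp_mul_gaussianCorrection_eq]
  rw [integral_finsetSum _ fun m _ => integrable_finsetSum _ fun j _ => hi m j]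
  simp_rw [integral_finsetSum _ fun j _ => hi _ j, integral_const_mul]
  rw [Finset.sum_range_two_mul_add_one_of_odd_eq_zero, Finset.mul_sum]
  · refine Finset.sum_congr rfl fun k hk => ?_
    have hk' : 2 * k + 1 ≤ 2 * N + 1 := by simp at hk; omega
    have hn' : (1 / √(n : ℝ)) ^ (2 * k) = 1 / (n : ℝ) ^ k := by
      rw [pow_mul, div_pow, Real.sq_sqrt n.cast_nonneg, one_pow, one_div_pow]
    -- Terms with j > 2k vanish because X^j divides (R - 1)^j, so the range of j no longer depends
    -- on N.
    rw [← Finset.sum_subset (Finset.range_subset_range.2 hk') fun j _ hj => by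
      rw [coeff_expRemainderSeries_sub_one_pow_of_lt (by simp at hj; omega)]; ring,
      laplaceCoeff, Finset.sum_div, Finset.mul_sum]
    refine Finset.sum_congr rfl fun j _ => ?_
    rw [← mul_add, integral_even_pow_mul_exp_neg_sq_div_two, hn']
    ring
  · intro m hm
    refine Finset.sum_eq_zero fun j _ => ?_
    rw [integral_odd_pow_mul_exp_neg_sq_div_two (hm.add_even (even_two_mul j)), mul_zero]

theorem integrable_exp_neg_gammaPhase {n : ℕ} (hn : n ≠ 0) :
    Integrable fun x : ℝ => Real.exp (-gammaPhase n x) := by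
  obtain ⟨C, hC⟩ := exists_pow_mul_exp_neg_abs_le 0
  refine (integrable_inv_one_add_sq.const_mul (Real.exp (1 / 4) * C)).mono'
    (Real.continuous_exp.comp (continuous_gammaPhase n).neg).aestronglyMeasurable
    (Eventually.of_forall fun x => ?_)
  rw [Real.norm_eq_abs, Real.abs_exp, mul_assoc]
  refine (exp_neg_gammaPhase_le hn x).trans (mul_le_mul_of_nonneg_left ?_ (Real.exp_pos _).le)
  simpa using hC x

theorem isStirlingCoefficients_laplaceCoeff : IsStirlingCoefficients laplaceCoeff := by
  intro N
  -- Order 2N + 1 keeps every power up to n^{-N} and leaves an error O(n^{-N-1/2}), which is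
  -- o(n^{-N}).
  obtain ⟨C, hC⟩ := exists_abs_exp_neg_gammaPhase_sub_le (2 * N + 1)
  have hbig : (fun n : ℕ => (n.factorial : ℝ) /
      ((n : ℝ) ^ n * Real.exp (-(n : ℝ)) * Real.sqrt (2 * Real.pi * (n : ℝ))) -
      ∑ k ∈ Finset.range (N + 1), laplaceCoeff k / (n : ℝ) ^ k)
      =O[atTop] (fun n : ℕ => (1 / √(n : ℝ)) ^ (2 * N + 1)) := by
    refine IsBigO.of_bound ((√(2 * Real.pi))⁻¹ * (C * Real.pi)) ?_
    filter_upwards [eventually_ne_atTop 0] with n hn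
    have hn' : (0 : ℝ) < n := by positivity
    have hpi : 0 < √(2 * Real.pi) := Real.sqrt_pos.2 (by positivity)
    have hs : 0 < √(n : ℝ) := Real.sqrt_pos.2 hn'
    have heq : (n.factorial : ℝ) /
        ((n : ℝ) ^ n * Real.exp (-(n : ℝ)) * Real.sqrt (2 * Real.pi * (n : ℝ))) -
        ∑ k ∈ Finset.range (N + 1), laplaceCoeff k / (n : ℝ) ^ k =
        (√(2 * Real.pi))⁻¹ * ∫ x : ℝ, (Real.exp (-gammaPhase n x) -
          Real.exp (-x ^ 2 / 2) * gaussianCorrection (2 * N + 1) (x / √n) x) := by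
      rw [integral_sub (integrable_exp_neg_gammaPhase hn)
        (integrable_exp_mul_gaussianCorrection _ _), integral_exp_mul_gaussianCorrection,
        factorial_eq_integral_gammaPhase hn, Real.sqrt_mul (by positivity)]
      field_simp
    rw [heq, norm_mul, Real.norm_of_nonneg (by positivity : 0 ≤ (√(2 * Real.pi))⁻¹), mul_assoc,
      Real.norm_of_nonneg (by positivity : 0 ≤ (1 / √(n : ℝ)) ^ (2 * N + 1))]
    refine mul_le_mul_of_nonneg_left ?_ (by positivity)
    refine (norm_integral_le_of_norm_le
      (integrable_inv_one_add_sq.const_mul (C * (1 / √n) ^ (2 * N + 1)))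
      (Eventually.of_forall fun x => hC n hn x)).trans_eq ?_
    rw [integral_const_mul, integral_univ_inv_one_add_sq]
    ring
  refine hbig.trans_isLittleO ?_
  have hlim : Tendsto (fun n : ℕ => 1 / √(n : ℝ)) atTop (𝓝 0) := by
    simp_rw [one_div]
    exact (Real.tendsto_sqrt_atTop.comp tendsto_natCast_atTop_atTop).inv_tendsto_atTop
  have h := ((isLittleO_one_iff ℝ).2 hlim).mul_isBigO
    (isBigO_refl (fun n : ℕ => 1 / (n : ℝ) ^ N) atTop)
  refine h.congr (fun n => ?_) (fun n => one_mul _)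
  rw [pow_succ, pow_mul, div_pow, Real.sq_sqrt n.cast_nonneg, one_pow, one_div_pow, mul_comm]

/-! ### Uniqueness and conclusion -/

theorem HasAsymptoticExpansion.unique {f a b : ℕ → ℝ} (ha : HasAsymptoticExpansion f a)
    (hb : HasAsymptoticExpansion f b) : a = b := by
  funext N
  induction N using Nat.strong_induction_on with
  | _ N ih =>
    have h := (hb N).sub (ha N)
    -- The earlier coefficients agree by induction, so subtracting the two expansions leaves only
    -- the N-th term.
    have hdiff : (fun n : ℕ => (a N - b N) * (1 / (n : ℝ) ^ N))
        =o[atTop] (fun n : ℕ => 1 / (n : ℝ) ^ N) := by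
      refine h.congr_left fun n => ?_
      rw [Finset.sum_range_succ, Finset.sum_range_succ,
        Finset.sum_congr rfl fun k hk => by rw [← ih k (Finset.mem_range.1 hk)]]
      ring
    by_contra hne
    have hself := (isLittleO_const_mul_left_iff (sub_ne_zero.2 hne)).1 hdiff
    have hev : ∃ᶠ n : ℕ in atTop, 1 / (n : ℝ) ^ N ≠ 0 := by
      refine Eventually.frequently ?_
      filter_upwards [eventually_ne_atTop 0] with n hn
      positivity
    exact isLittleO_irrefl hev hself

theorem theorem1 (a : ℕ → ℝ) :
    IsStirlingCoefficients a ↔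
      ∀ k : ℕ, a k = ((2 * k).factorial : ℝ) / (2 ^ k * (k.factorial : ℝ)) *
        ∑ i ∈ Finset.range (2 * k + 1),
          Ring.choose ((k : ℝ) + (i : ℝ) - 1 / 2) i *
          Ring.choose (3 * (k : ℝ) + 1 / 2) (2 * k - i) * 2 ^ i *
          ∑ j ∈ Finset.range (i + 1),
            (i.choose j : ℝ) * (-1) ^ j * (j.factorial : ℝ) *
              ((Nat.stirlingSecond (2 * k + i + j) j : ℝ) /
                ((2 * k + i + j).factorial : ℝ)) := by
  simp_rw [← sum_gaussianMoment_mul_coeff]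
  constructor
  · intro h k
    exact congrFun (h.unique isStirlingCoefficients_laplaceCoeff) k
  · intro h
    rw [show a = laplaceCoeff from funext h]
    exact isStirlingCoefficients_laplaceCoeff
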